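/- Let $n\ge 3$ and let $K\subset\mathbb{R}^n$ be a strictly convex body, i.e. a compact, strictly convex set with non-empty interior. For $x\in\mathbb{R}^n\setminus K$ let the support double-cone of $K$ with apex $x$, denoted $C_x$, be the boundary of the solid double-cone $\bigcup_{z\in K}\operatorname{aff}\{x,z\}$, where $\operatorname{aff}\{x,z\}$ is the affine hull of $x$ and $z$. Let $L\subset\mathbb{R}^n$ be the image of an embedding $\mathbb{S}^{n-1}\to\mathbb{R}^n$ (a homeomorphism onto its image), and suppose that $K$ is contained in the interior of $L$, i.e. in the bounded component of $\mathbb{R}^n\setminus L$. Suppose that for every $x\in L$ there are a point $y\in L$ with $y\neq x$ and a vector $p\in\mathbb{R}^n$ such that $$C_y=p+C_x .$$ Then $K$ and $L$ are centrally symmetric and concentric: there is a point $c\in\mathbb{R}^n$ such that $2c-K=K$ and $2c-L=L$. -/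

import Mathlib

open scoped Pointwise

/-- A convex body: a compact convex set with non-empty interior. -/
def IsConvexBody {n : ℕ} (K : Set (EuclideanSpace ℝ (Fin n))) : Prop :=
  IsCompact K ∧ Convex ℝ K ∧ (interior K).Nonempty

/-- A strictly convex body: a convex body that is strictly convex as a set
(equivalently, whose boundary contains no non-degenerate line segment). -/
def IsStrictlyConvexBody {n : ℕ} (K : Set (EuclideanSpace ℝ (Fin n))) : Prop :=
  IsConvexBody K ∧ StrictConvex ℝ K

/-- `L` is the image of a topological embedding (a homeomorphism onto its image) of the unit
sphere of `ℝⁿ`. -/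
def IsEmbeddedSphere {n : ℕ} (L : Set (EuclideanSpace ℝ (Fin n))) : Prop :=
  ∃ α : Metric.sphere (0 : EuclideanSpace ℝ (Fin n)) 1 → EuclideanSpace ℝ (Fin n),
    Topology.IsEmbedding α ∧ Set.range α = L

/-- The region enclosed by `L`: the points off `L` whose connected component in the complement
of `L` is bounded. -/
def enclosedRegion {n : ℕ} (L : Set (EuclideanSpace ℝ (Fin n))) :
    Set (EuclideanSpace ℝ (Fin n)) :=
  {z | z ∉ L ∧ Bornology.IsBounded (connectedComponentIn Lᶜ z)}

/-- The solid double-cone generated by `K` and `x`: the union of the affine hulls of `{x, y}`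
over all `y ∈ K`. -/
def solidDoubleCone {n : ℕ} (K : Set (EuclideanSpace ℝ (Fin n)))
    (x : EuclideanSpace ℝ (Fin n)) : Set (EuclideanSpace ℝ (Fin n)) :=
  ⋃ y ∈ K, (affineSpan ℝ {x, y} : Set (EuclideanSpace ℝ (Fin n)))

/-- The support double-cone of `K` with apex `x`: the boundary of the solid double-cone. -/
def supportDoubleCone {n : ℕ} (K : Set (EuclideanSpace ℝ (Fin n)))
    (x : EuclideanSpace ℝ (Fin n)) : Set (EuclideanSpace ℝ (Fin n)) :=
  frontier (solidDoubleCone K x)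

/-- `M` is centrally symmetric with center `q`: `2q - M = M`. -/
def IsCentrallySymmetric {n : ℕ} (M : Set (EuclideanSpace ℝ (Fin n)))
    (q : EuclideanSpace ℝ (Fin n)) : Prop :=
  (fun z => (2 : ℝ) • q - z) '' M = M

/-!
Write `σ x` for a point of `L`, distinct from `x`, whose support double-cone is a translate of that
of `x`.

*The cones at `x` and `σ x` are opposite.* The boundary of a double cone determines its apex
(`eq_zero_of_frontier_lineCone_translate`), so the translation carries `x` to `σ x`. In dimension at
least three the boundary also determines the pair of nappes
(`supportsAt_zero_of_frontier_lineCone_eq`). If the nappes containing `K` corresponded to each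
other, `x` and `σ x` would lie on the same supporting hyperplanes of `K`; the normals of those
through `x` span the space, so this would give `σ x = x`. Hence they are interchanged: if the
hyperplane through `x` with outer normal `u` supports `K`, so does the one through `σ x` with outer
normal `-u`. The spanning argument also shows that `σ` is an involution on `L`.

*`σ` preserves directions.* If the line `x x'` misses `K`, the normals of the supporting hyperplanes
containing it span the orthogonal complement of `x' - x`, again because the dimension is at least
three (`exists_supportsAt_inner_ne_zero`). Each such hyperplane is mapped to a parallel one, so
`σ x' - σ x` is a multiple of `x' - x`. In a supporting hyperplane `H` with contact point `z`,
unique by strict convexity, this applies to all `x, x'` in `L ∩ H` not collinear with `z`. As `L`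
encloses `K`, every ray from `z` in `H` meets `L`, and comparing triangles with vertices on `L`
gives `σ x = t • x + c` on `L ∩ H` (`exists_eq_smul_add_on_supporting_hyperplane`).

*The formula is global.* Supporting hyperplanes with nearby normals intersect close to their contact
points, hence inside `L`; their intersection contains a line through a point inside `L`, and so two
points of `L`. Thus `t` and `c` are locally constant functions of the normal, hence constant
(`exists_eq_smul_add_of_supportsAt_neg`).

Since `σ` is an involution without fixed points, `t = -1`. So `L` is invariant under `x ↦ c - x`,
and opposite supporting hyperplanes of `K` are exchanged by this reflection, so `K` is invariant
too.
-/

open scoped RealInnerProductSpace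

/-! ### Normals of supporting hyperplanes -/

section InnerProduct

variable {E : Type*} [NormedAddCommGroup E] [InnerProductSpace ℝ E]

theorem exists_ne_zero_inner_eq_zero_of_three_le_finrank [FiniteDimensional ℝ E]
    (hE : 3 ≤ Module.finrank ℝ E) (a b : E) :
    ∃ v : E, v ≠ 0 ∧ ⟪a, v⟫ = 0 ∧ ⟪b, v⟫ = 0 := by
  classical
  have h2 : Module.finrank ℝ (Submodule.span ℝ ({a, b} : Set E)) ≤ 2 := by
    have h := finrank_span_finset_le_card (R := ℝ) ({a, b} : Finset E)
    have h' : ({a, b} : Finset E).card ≤ 2 := Finset.card_le_two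
    simp only [Finset.coe_insert, Finset.coe_singleton] at h
    exact h.trans h'
  have hne : (Submodule.span ℝ ({a, b} : Set E))ᗮ ≠ ⊥ := by
    intro h
    have := (Submodule.span ℝ ({a, b} : Set E)).finrank_add_finrank_orthogonal
    rw [h, finrank_bot] at this
    omega
  obtain ⟨v, hv, hv0⟩ := Submodule.exists_mem_ne_zero_of_ne_bot hne
  rw [Submodule.mem_orthogonal] at hv
  exact ⟨v, hv0, hv a (Submodule.subset_span (by simp)), hv b (Submodule.subset_span (by simp))⟩

theorem exists_inner_pos_of_line_disjoint [CompleteSpace E] {K : Set E} (hK : IsCompact K)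
    (hc : Convex ℝ K) {x d : E} (hd : ∀ r : ℝ, x + r • d ∉ K) :
    ∃ u : E, ⟪u, d⟫ = 0 ∧ ∀ k ∈ K, 0 < ⟪u, k - x⟫ := by
  have hline : IsClosed (AffineSubspace.mk' x (Submodule.span ℝ {d}) : Set E) := by
    have : (AffineSubspace.mk' x (Submodule.span ℝ {d}) : Set E)
        = (fun w => w - x) ⁻¹' (Submodule.span ℝ {d} : Set E) := by
      ext w
      simp [AffineSubspace.mem_mk']
    rw [this]
    exact (Submodule.closed_of_finiteDimensional _).preimage (by fun_prop)
  have hdisj : Disjoint (AffineSubspace.mk' x (Submodule.span ℝ {d}) : Set E) K := by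
    rw [Set.disjoint_left]
    intro w hw hwK
    rw [SetLike.mem_coe, AffineSubspace.mem_mk', Submodule.mem_span_singleton] at hw
    obtain ⟨r, hr⟩ := hw
    refine hd r ?_
    rw [hr]
    simpa using hwK
  obtain ⟨f, s, t, hs, hst, ht⟩ := geometric_hahn_banach_closed_compact
    (AffineSubspace.convex _) hline hc hK hdisj
  have hmem : ∀ r : ℝ, f (x + r • d) < s := fun r => hs _ (by
    rw [SetLike.mem_coe, AffineSubspace.mem_mk', Submodule.mem_span_singleton]
    exact ⟨r, by simp⟩)
  -- A linear functional bounded above on a line is constant along it.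
  have hfd : f d = 0 := by
    by_contra h
    have := hmem ((s - f x) / f d)
    rw [map_add, map_smul, smul_eq_mul, div_mul_cancel₀ _ h] at this
    linarith
  refine ⟨(InnerProductSpace.toDual ℝ E).symm f, ?_, fun k hk => ?_⟩
  · rw [InnerProductSpace.toDual_symm_apply, hfd]
  · rw [InnerProductSpace.toDual_symm_apply, map_sub]
    have h0 := hmem 0
    rw [zero_smul, add_zero] at h0
    linarith [ht k hk]

theorem inner_lt_of_mem_interior {K : Set E} {u m : E} (hu : u ≠ 0) (hm : m ∈ interior K) :
    ∃ k ∈ K, ⟪u, m⟫ < ⟪u, k⟫ := by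
  by_contra! h
  have hcont : ContinuousAt (fun s : ℝ => m + s • u) 0 := by fun_prop
  obtain ⟨ε, hε, hball⟩ := Metric.eventually_nhds_iff.1
    (hcont.eventually_mem (by simpa using mem_interior_iff_mem_nhds.1 hm))
  have h1 := h _ (hball (y := ε / 2) (by rw [Real.dist_eq, sub_zero, abs_of_pos] <;> linarith))
  rw [inner_add_right, inner_smul_right] at h1
  have : 0 < ε / 2 * ⟪u, u⟫ := mul_pos (by linarith) (real_inner_self_pos.2 hu)
  linarith

theorem eq_zero_of_inner_eq_const {K : Set E} (hK : (interior K).Nonempty) {e : E} {a : ℝ}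
    (h : ∀ k ∈ K, ⟪e, k⟫ = a) : e = 0 := by
  by_contra he
  obtain ⟨m, hm⟩ := hK
  obtain ⟨k, hk, hlt⟩ := inner_lt_of_mem_interior he hm
  rw [h k hk, h m (interior_subset hm)] at hlt
  exact lt_irrefl a hlt

/-- The hyperplane through `x` with outer normal `u` supports `K`. The degenerate normal `u = 0`
is allowed. -/
def SupportsAt (K : Set E) (u x : E) : Prop :=
  (∀ k ∈ K, ⟪u, k⟫ ≤ ⟪u, x⟫) ∧ ∃ k ∈ K, ⟪u, k⟫ = ⟪u, x⟫

theorem SupportsAt.inner_eq {K : Set E} {u x y : E} (hx : SupportsAt K u x)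
    (hy : SupportsAt K u y) : ⟪u, x⟫ = ⟪u, y⟫ := by
  obtain ⟨k, hk, hkx⟩ := hx.2
  obtain ⟨l, hl, hly⟩ := hy.2
  exact le_antisymm (hkx ▸ hy.1 k hk) (hly ▸ hx.1 l hl)

theorem SupportsAt.of_inner_eq {K : Set E} {u x y : E} (hx : SupportsAt K u x)
    (h : ⟪u, y⟫ = ⟪u, x⟫) : SupportsAt K u y := by
  unfold SupportsAt
  rw [h]
  exact hx

/-- If the line `x + ℝ d` misses the convex body `K`, the normals of the supporting hyperplanes of
`K` containing this line span the orthogonal complement of `d`; that is, a vector orthogonal to all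
of them is a multiple of `d`. For `d = 0` the normals of the supporting hyperplanes through the
point `x` span the whole space. -/
theorem exists_supportsAt_inner_ne_zero [FiniteDimensional ℝ E] (hE : 3 ≤ Module.finrank ℝ E)
    {K : Set E} (hK : IsCompact K) (hc : Convex ℝ K) (hi : (interior K).Nonempty) {x d : E}
    (hd : ∀ r : ℝ, x + r • d ∉ K) {w : E} (hw : ∀ r : ℝ, w ≠ r • d) :
    ∃ u : E, SupportsAt K u x ∧ ⟪u, d⟫ = 0 ∧ ⟪u, w⟫ ≠ 0 := by
  have hne : K.Nonempty := hi.mono interior_subset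
  obtain ⟨v, hvd, hv⟩ := exists_inner_pos_of_line_disjoint hK hc hd
  -- Rotate the separating normal `-v` towards `e` until the hyperplane touches `K`.
  have key : ∀ e : E, ∃ M : ℝ, SupportsAt K (e - M • v) x := by
    intro e
    have hcont : ContinuousOn (fun k => ⟪e, k - x⟫ / ⟪v, k - x⟫) K :=
      ContinuousOn.div (by fun_prop) (by fun_prop) fun k hk => (hv k hk).ne'
    obtain ⟨k₀, hk₀, hmax⟩ := hK.exists_isMaxOn hne hcont
    refine ⟨⟪e, k₀ - x⟫ / ⟪v, k₀ - x⟫, fun k hk => ?_, k₀, hk₀, ?_⟩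
    · have h1 : ⟪e, k - x⟫ / ⟪v, k - x⟫ ≤ _ := hmax hk
      rw [div_le_iff₀ (hv k hk)] at h1
      rw [← sub_nonpos, ← inner_sub_right, inner_sub_left, real_inner_smul_left]
      linarith
    · rw [← sub_eq_zero, ← inner_sub_right, inner_sub_left, real_inner_smul_left,
        div_mul_cancel₀ _ (hv k₀ hk₀).ne', sub_self]
  by_cases hvw : ⟪v, w⟫ = 0
  · -- Here `e` is `w` made orthogonal to `d`.
    obtain ⟨M, hM⟩ := key (w - (⟪d, w⟫ / ⟪d, d⟫) • d)
    have horth : ⟪w - (⟪d, w⟫ / ⟪d, d⟫) • d, d⟫ = 0 := by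
      by_cases hd0 : d = 0
      · simp [hd0]
      · rw [inner_sub_left, real_inner_smul_left, div_mul_cancel₀ _ (inner_self_ne_zero.2 hd0),
          real_inner_comm, sub_self]
    refine ⟨_, hM, ?_, ?_⟩
    · rw [inner_sub_left, horth, real_inner_smul_left, hvd]
      simp
    · rw [inner_sub_left, real_inner_smul_left, hvw, mul_zero, sub_zero]
      intro h
      apply hw (⟪d, w⟫ / ⟪d, d⟫)
      rw [← sub_eq_zero, ← inner_self_eq_zero (𝕜 := ℝ)]
      rw [inner_sub_right, h, real_inner_smul_right, horth]
      simp
  · obtain ⟨e, he0, hde, hve⟩ := exists_ne_zero_inner_eq_zero_of_three_le_finrank hE d v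
    obtain ⟨M, hM⟩ := key e
    obtain ⟨M', hM'⟩ := key (-e)
    by_cases h1 : ⟪e - M • v, w⟫ = 0
    · by_cases h2 : ⟪-e - M' • v, w⟫ = 0
      · -- If both normals were orthogonal to `w`, they would be opposite, so `K` would lie in a
        -- hyperplane.
        exfalso
        rw [inner_sub_left, real_inner_smul_left] at h1
        rw [inner_sub_left, real_inner_smul_left, inner_neg_left] at h2
        have h3 : M' = -M := by
          have : (M + M') * ⟪v, w⟫ = 0 := by linarith
          rcases mul_eq_zero.1 this with h | h
          · linarith
          · exact absurd h hvw
        have h4 : -e - M' • v = -(e - M • v) := by rw [h3]; module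
        rw [h4] at hM'
        have h5 : e - M • v = 0 := by
          refine eq_zero_of_inner_eq_const hi (a := ⟪e - M • v, x⟫) fun k hk =>
            le_antisymm (hM.1 k hk) ?_
          have := hM'.1 k hk
          rw [inner_neg_left, inner_neg_left] at this
          linarith
        apply he0
        rw [← inner_self_eq_zero (𝕜 := ℝ)]
        have h6 : ⟪e - M • v, e⟫ = 0 := by rw [h5, inner_zero_left]
        rwa [inner_sub_left, real_inner_smul_left, hve, mul_zero, sub_zero] at h6
      · refine ⟨_, hM', ?_, h2⟩
        rw [inner_sub_left, real_inner_smul_left, hvd, inner_neg_left, real_inner_comm, hde]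
        simp
    · refine ⟨_, hM, ?_, h1⟩
      rw [inner_sub_left, real_inner_smul_left, hvd, real_inner_comm, hde]
      simp

end InnerProduct

/-! ### Double cones and their frontiers -/

section Cones

variable {E : Type*} [NormedAddCommGroup E] [InnerProductSpace ℝ E]

/-- The union of the lines joining the origin to the points of `Q`. -/
def lineCone (Q : Set E) : Set E := {w | ∃ q ∈ Q, ∃ r : ℝ, w = r • q}

theorem subset_lineCone (Q : Set E) : Q ⊆ lineCone Q := fun q hq => ⟨q, hq, 1, by simp⟩

theorem smul_mem_lineCone {Q : Set E} {w : E} (hw : w ∈ lineCone Q) (r : ℝ) :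
    r • w ∈ lineCone Q := by
  obtain ⟨q, hq, s, rfl⟩ := hw
  exact ⟨q, hq, r * s, by rw [mul_smul]⟩

theorem lineCone_neg (Q : Set E) : lineCone (-Q) = lineCone Q := by
  ext w
  constructor
  · rintro ⟨q, hq, r, rfl⟩
    exact ⟨-q, hq, -r, by simp⟩
  · rintro ⟨q, hq, r, rfl⟩
    exact ⟨-q, by simpa using hq, -r, by simp⟩

theorem smul_mem_frontier_lineCone {Q : Set E} {w : E} (hw : w ∈ frontier (lineCone Q)) {r : ℝ}
    (hr : r ≠ 0) : r • w ∈ frontier (lineCone Q) := by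
  have h : lineCone Q = (Homeomorph.smulOfNeZero r⁻¹ (inv_ne_zero hr)) ⁻¹' lineCone Q := by
    ext w
    refine ⟨fun h => smul_mem_lineCone h _, fun h => ?_⟩
    have := smul_mem_lineCone h r
    simpa [smul_smul, hr] using this
  rw [h, ← Homeomorph.preimage_frontier]
  simpa [smul_smul, hr] using hw

variable {Q : Set E} {u : E}

theorem eq_zero_of_mem_lineCone (hu : ∀ q ∈ Q, 0 < ⟪u, q⟫) {w : E} (hw : w ∈ lineCone Q)
    (h : ⟪u, w⟫ = 0) : w = 0 := by
  obtain ⟨q, hq, r, rfl⟩ := hw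
  rw [inner_smul_right] at h
  rcases mul_eq_zero.1 h with h | h
  · rw [h, zero_smul]
  · exact absurd h (hu q hq).ne'

theorem exists_pos_smul_of_mem_lineCone (hu : ∀ q ∈ Q, 0 < ⟪u, q⟫) {w : E} (hw : w ∈ lineCone Q)
    (h : 0 < ⟪u, w⟫) : ∃ q ∈ Q, ∃ r : ℝ, 0 < r ∧ w = r • q := by
  obtain ⟨q, hq, r, rfl⟩ := hw
  rw [inner_smul_right] at h
  exact ⟨q, hq, r, pos_of_mul_pos_left h (hu q hq).le, rfl⟩

theorem add_mem_lineCone (hQ : Convex ℝ Q) (hu : ∀ q ∈ Q, 0 < ⟪u, q⟫) {v w : E}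
    (hv : v ∈ lineCone Q) (hw : w ∈ lineCone Q) (hv0 : 0 < ⟪u, v⟫) (hw0 : 0 < ⟪u, w⟫) :
    v + w ∈ lineCone Q := by
  obtain ⟨q, hq, r, hr, rfl⟩ := exists_pos_smul_of_mem_lineCone hu hv hv0
  obtain ⟨p, hp, s, hs, rfl⟩ := exists_pos_smul_of_mem_lineCone hu hw hw0
  refine ⟨(r / (r + s)) • q + (s / (r + s)) • p, hQ hq hp (by positivity) (by positivity)
    (by field_simp), r + s, ?_⟩
  rw [smul_add, smul_smul, smul_smul]
  congr 2 <;> field_simp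

theorem isClosed_lineCone (hQ : IsCompact Q) (hu : ∀ q ∈ Q, 0 < ⟪u, q⟫) :
    IsClosed (lineCone Q) := by
  have : CompactSpace Q := isCompact_iff_compactSpace.1 hQ
  -- `w = r • q` forces `r = ⟪u, w⟫ / ⟪u, q⟫`, so the cone is a projection along the compact set `Q`.
  have h : lineCone Q = Prod.snd '' {p : Q × E | ⟪u, (p.1 : E)⟫ • p.2 = ⟪u, p.2⟫ • (p.1 : E)} := by
    ext w
    constructor
    · rintro ⟨q, hq, r, rfl⟩
      refine ⟨(⟨q, hq⟩, r • q), ?_, rfl⟩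
      simp only [Set.mem_ofPred_eq, inner_smul_right, smul_smul]
      rw [mul_comm]
    · rintro ⟨⟨⟨q, hq⟩, w'⟩, hw, rfl⟩
      refine ⟨q, hq, ⟪u, w'⟫ / ⟪u, q⟫, ?_⟩
      have h0 := (hu q hq).ne'
      simp only [Set.mem_ofPred_eq] at hw
      rw [div_eq_inv_mul, mul_smul, ← hw, smul_smul, inv_mul_cancel₀ h0, one_smul]
  rw [h]
  exact isClosedMap_snd_of_compactSpace _ (isClosed_eq (by fun_prop) (by fun_prop))

theorem exists_norm_le_mul_abs_inner (hQ : IsCompact Q) (hu : ∀ q ∈ Q, 0 < ⟪u, q⟫) :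
    ∃ R : ℝ, ∀ w ∈ lineCone Q, ‖w‖ ≤ R * |⟪u, w⟫| := by
  have hcont : ContinuousOn (fun q => ‖q‖ / ⟪u, q⟫) Q :=
    ContinuousOn.div (by fun_prop) (by fun_prop) fun q hq => (hu q hq).ne'
  obtain ⟨R, hR⟩ := hQ.bddAbove_image hcont
  refine ⟨R, ?_⟩
  rintro _ ⟨q, hq, r, rfl⟩
  have h1 : ‖q‖ / ⟪u, q⟫ ≤ R := hR ⟨q, hq, rfl⟩
  rw [div_le_iff₀ (hu q hq)] at h1
  rw [norm_smul, inner_smul_right, abs_mul, abs_of_pos (hu q hq), Real.norm_eq_abs]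
  nlinarith [abs_nonneg r]

/-- The slices of the cone parallel to the hyperplane `⟪u, ·⟫ = 0` are bounded, so moving inside
such a slice one leaves the cone. -/
theorem exists_add_smul_mem_frontier_lineCone (hQ : IsCompact Q) (hu : ∀ q ∈ Q, 0 < ⟪u, q⟫)
    {w v : E} (hw : w ∈ lineCone Q) (hv : ⟪u, v⟫ = 0) (hv0 : v ≠ 0) :
    ∃ s : ℝ, 0 ≤ s ∧ w + s • v ∈ frontier (lineCone Q) := by
  have hcl := isClosed_lineCone hQ hu
  obtain ⟨R, hR⟩ := exists_norm_le_mul_abs_inner hQ hu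
  set T : Set ℝ := {s | 0 ≤ s ∧ w + s • v ∈ lineCone Q} with hT
  have hTc : IsClosed T := isClosed_Ici.inter (hcl.preimage (by fun_prop))
  have hTne : T.Nonempty := ⟨0, le_rfl, by simpa using hw⟩
  have hTb : BddAbove T := by
    refine ⟨(R * |⟪u, w⟫| + ‖w‖) / ‖v‖, ?_⟩
    rintro s ⟨hs0, hs⟩
    rw [le_div_iff₀ (norm_pos_iff.2 hv0)]
    have h1 := hR _ hs
    rw [inner_add_right, inner_smul_right, hv, mul_zero, add_zero] at h1
    have h2 : ‖s • v‖ ≤ ‖w + s • v‖ + ‖w‖ := by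
      have := norm_sub_le (w + s • v) w
      rwa [add_sub_cancel_left] at this
    rw [norm_smul, Real.norm_of_nonneg hs0] at h2
    linarith
  have hmem : sSup T ∈ T := hTc.csSup_mem hTne hTb
  refine ⟨sSup T, hmem.1, ?_⟩
  rw [hcl.frontier_eq]
  refine ⟨hmem.2, fun hint => ?_⟩
  have hcont : ContinuousAt (fun s : ℝ => w + s • v) (sSup T) := by fun_prop
  obtain ⟨ε, hε, hball⟩ := Metric.eventually_nhds_iff.1
    (hcont.eventually_mem (mem_interior_iff_mem_nhds.1 hint))
  have h1 : sSup T + ε / 2 ∈ T := by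
    refine ⟨by linarith [hmem.1], hball ?_⟩
    rw [Real.dist_eq, add_sub_cancel_left, abs_of_pos] <;> linarith
  linarith [le_csSup hTb h1]

/-- The frontier of a double cone determines its apex: it is not the translate by a nonzero
vector of the frontier of another double cone with apex `0`. -/
theorem eq_zero_of_frontier_lineCone_translate [FiniteDimensional ℝ E]
    (hE : 3 ≤ Module.finrank ℝ E) (hQ : IsCompact Q) (hi : (interior Q).Nonempty)
    (hu : ∀ q ∈ Q, 0 < ⟪u, q⟫) {Q' : Set E} {q : E}
    (h : ∀ w, w ∈ frontier (lineCone Q') ↔ w - q ∈ frontier (lineCone Q)) : q = 0 := by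
  by_contra hq
  have hsub : frontier (lineCone Q) ⊆ lineCone Q := (isClosed_lineCone hQ hu).frontier_subset
  obtain ⟨R, hR⟩ := exists_norm_le_mul_abs_inner hQ hu
  -- Both frontiers are invariant under dilations, so that of `lineCone Q` is invariant under
  -- translation by multiples of `q`.
  have h2 : ∀ b ∈ frontier (lineCone Q), b + (-2 : ℝ) • q ∈ frontier (lineCone Q) := by
    intro b hb
    have h1 : (-1 : ℝ) • b + q ∈ frontier (lineCone Q') := by
      rw [h, add_sub_cancel_right]
      exact smul_mem_frontier_lineCone hb (by norm_num)
    have h3 := smul_mem_frontier_lineCone h1 (r := -1) (by norm_num)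
    rw [h] at h3
    have h4 : (-1 : ℝ) • ((-1 : ℝ) • b + q) - q = b + (-2 : ℝ) • q := by module
    rwa [h4] at h3
  have htrans : ∀ b ∈ frontier (lineCone Q), ∀ s : ℝ, b + s • q ∈ lineCone Q := by
    intro b hb s
    by_cases hs : s = 0
    · simpa [hs] using hsub hb
    · have h3 := h2 _ (smul_mem_frontier_lineCone hb (r := -2 / s)
        (div_ne_zero (by norm_num) hs))
      have h4 := smul_mem_frontier_lineCone h3 (r := s / -2) (div_ne_zero hs (by norm_num))
      have h5 : (s / -2) • ((-2 / s) • b + (-2 : ℝ) • q) = b + s • q := by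
        rw [smul_add, smul_smul, smul_smul]
        congr 1
        · rw [show s / -2 * (-2 / s) = 1 by field_simp, one_smul]
        · congr 1; ring
      rw [h5] at h4
      exact hsub h4
  obtain ⟨w, hw⟩ := hi
  obtain ⟨v, hv0, huv, -⟩ := exists_ne_zero_inner_eq_zero_of_three_le_finrank hE u u
  have hwi : w ∈ interior (lineCone Q) := interior_mono (subset_lineCone Q) hw
  obtain ⟨s, hs, hb⟩ :=
    exists_add_smul_mem_frontier_lineCone hQ hu (interior_subset hwi) huv hv0
  obtain ⟨s', hs', hb'⟩ := exists_add_smul_mem_frontier_lineCone hQ hu (interior_subset hwi)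
    (v := -v) (by rw [inner_neg_right, huv, neg_zero]) (neg_ne_zero.2 hv0)
  by_cases huq : ⟪u, q⟫ = 0
  · -- An unbounded line in a bounded slice.
    have h3 := hR _ (htrans _ hb
      ((R * |⟪u, w + s • v⟫| + ‖w + s • v‖ + 1) / ‖q‖))
    rw [inner_add_right _ _ (_ • q), inner_smul_right _ q, huq, mul_zero, add_zero] at h3
    have h4 : ‖((R * |⟪u, w + s • v⟫| + ‖w + s • v‖ + 1) / ‖q‖) • q‖
        ≤ R * |⟪u, w + s • v⟫| + ‖w + s • v‖ := by
      have := norm_sub_le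
        (w + s • v + ((R * |⟪u, w + s • v⟫| + ‖w + s • v‖ + 1) / ‖q‖) • q) (w + s • v)
      rw [add_sub_cancel_left] at this
      linarith
    rw [norm_smul, Real.norm_eq_abs, abs_div, abs_norm,
      div_mul_cancel₀ _ (norm_ne_zero_iff.2 hq)] at h4
    linarith [le_abs_self (R * |⟪u, w + s • v⟫| + ‖w + s • v‖ + 1)]
  · -- The frontier lies on the line `ℝ q`, on which the slice through `w` has only one point.
    have hline : ∀ b ∈ frontier (lineCone Q), b = (⟪u, b⟫ / ⟪u, q⟫) • q := by
      intro b hb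
      have := eq_zero_of_mem_lineCone hu (htrans b hb (-(⟪u, b⟫ / ⟪u, q⟫)))
        (by rw [inner_add_right, inner_smul_right]; field_simp; ring)
      rwa [neg_smul, ← sub_eq_add_neg, sub_eq_zero] at this
    have h3 := hline _ hb
    have h4 := hline _ hb'
    rw [inner_add_right, inner_smul_right, inner_neg_right, huv, neg_zero, mul_zero, add_zero]
      at h4
    rw [inner_add_right, inner_smul_right, huv, mul_zero, add_zero, ← h4] at h3
    have h5 : (s + s') • v = 0 := by
      have : (s + s') • v = (w + s • v) - (w + s' • -v) := by module
      rw [this, h3, sub_self]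
    rcases smul_eq_zero.1 h5 with h5 | h5
    · have hs0 : s = 0 := by linarith
      rw [hs0, zero_smul, add_zero] at hb
      exact hb.2 hwi
    · exact hv0 h5

/-- If two double cones have the same frontier, then all frontier points on one side of the first
cone lie on the same side of the second one. This is where the connectedness of the frontier of a
nappe, hence dimension at least three, is used. -/
theorem inner_mul_inner_pos_of_frontier_lineCone_eq [FiniteDimensional ℝ E]
    (hE : 3 ≤ Module.finrank ℝ E) (hQ : IsCompact Q) (hc : Convex ℝ Q)
    (hu : ∀ q ∈ Q, 0 < ⟪u, q⟫) {Q' : Set E} {u' : E} (hQ' : IsCompact Q')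
    (hu' : ∀ q ∈ Q', 0 < ⟪u', q⟫) (h : frontier (lineCone Q) = frontier (lineCone Q')) {a b : E}
    (ha : a ∈ frontier (lineCone Q)) (hb : b ∈ frontier (lineCone Q)) (hua : 0 < ⟪u, a⟫)
    (hub : 0 < ⟪u, b⟫) : 0 < ⟪u', a⟫ * ⟪u', b⟫ := by
  have hsub : frontier (lineCone Q) ⊆ lineCone Q := (isClosed_lineCone hQ hu).frontier_subset
  have hsub' : frontier (lineCone Q') ⊆ lineCone Q' :=
    (isClosed_lineCone hQ' hu').frontier_subset
  -- A frontier point in the hyperplane `⟪u', ·⟫ = 0` is the apex.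
  have hne : ∀ z ∈ frontier (lineCone Q), 0 < ⟪u, z⟫ → ⟪u', z⟫ ≠ 0 := by
    intro z hz hz0 h0
    rw [h] at hz
    rw [eq_zero_of_mem_lineCone hu' (hsub' hz) h0, inner_zero_right] at hz0
    exact lt_irrefl _ hz0
  have hopp : ∀ a ∈ frontier (lineCone Q), ∀ b ∈ frontier (lineCone Q), 0 < ⟪u, a⟫ →
      0 < ⟪u, b⟫ → 0 < ⟪u', a⟫ → ¬ ⟪u', b⟫ < 0 := by
    intro a ha b hb hua hub ha' hb'
    obtain ⟨v, hv0, huv, hu'v⟩ := exists_ne_zero_inner_eq_zero_of_three_le_finrank hE u u'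
    have h1 : 0 < ⟪u, (-⟪u', b⟫) • a⟫ := by
      rw [inner_smul_right]; exact mul_pos (by linarith) hua
    have h2 : 0 < ⟪u, ⟪u', a⟫ • b⟫ := by
      rw [inner_smul_right]; exact mul_pos ha' hub
    have hmem := add_mem_lineCone hc hu (smul_mem_lineCone (hsub ha) (-⟪u', b⟫))
      (smul_mem_lineCone (hsub hb) ⟪u', a⟫) h1 h2
    obtain ⟨s, -, hs⟩ := exists_add_smul_mem_frontier_lineCone hQ hu hmem huv hv0
    refine hne _ hs ?_ ?_
    · rw [inner_add_right, inner_add_right, inner_smul_right u v, huv]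
      linarith
    · rw [inner_add_right, inner_add_right, inner_smul_right, inner_smul_right, inner_smul_right,
        hu'v]
      ring
  rcases lt_or_gt_of_ne (hne a ha hua) with h1 | h1 <;>
    rcases lt_or_gt_of_ne (hne b hb hub) with h2 | h2
  · exact mul_pos_of_neg_of_neg h1 h2
  · exact absurd h1 (hopp b hb a ha hub hua h2)
  · exact absurd h2 (hopp a ha b hb hua hub h1)
  · exact mul_pos h1 h2

/-- A nappe of a double cone is the convex hull of its frontier, so a nappe whose frontier lies on
the nappe of another double cone is contained in it. -/
theorem mem_lineCone_and_inner_pos_of_frontier [FiniteDimensional ℝ E]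
    (hE : 3 ≤ Module.finrank ℝ E) (hQ : IsCompact Q) (hu : ∀ q ∈ Q, 0 < ⟪u, q⟫) {Q' : Set E}
    {u' : E} (hc' : Convex ℝ Q') (hu' : ∀ q ∈ Q', 0 < ⟪u', q⟫)
    (h : ∀ b ∈ frontier (lineCone Q), 0 < ⟪u, b⟫ → b ∈ lineCone Q' ∧ 0 < ⟪u', b⟫) {w : E}
    (hw : w ∈ lineCone Q) (hw0 : 0 < ⟪u, w⟫) : w ∈ lineCone Q' ∧ 0 < ⟪u', w⟫ := by
  obtain ⟨v, hv0, huv, -⟩ := exists_ne_zero_inner_eq_zero_of_three_le_finrank hE u u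
  obtain ⟨s, hs, hb⟩ := exists_add_smul_mem_frontier_lineCone hQ hu hw huv hv0
  obtain ⟨s', hs', hb'⟩ := exists_add_smul_mem_frontier_lineCone hQ hu hw
    (v := -v) (by rw [inner_neg_right, huv, neg_zero]) (neg_ne_zero.2 hv0)
  obtain ⟨h1, h2⟩ := h _ hb (by rwa [inner_add_right, inner_smul_right, huv, mul_zero, add_zero])
  obtain ⟨h3, h4⟩ := h _ hb' (by
    rwa [inner_add_right, inner_smul_right, inner_neg_right, huv, neg_zero, mul_zero, add_zero])
  rcases hs.eq_or_lt with hs0 | hs0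
  · rw [← hs0, zero_smul, add_zero] at h1 h2
    exact ⟨h1, h2⟩
  rcases hs'.eq_or_lt with hs0' | hs0'
  · rw [← hs0', zero_smul, add_zero] at h3 h4
    exact ⟨h3, h4⟩
  have heq : w = (s' / (s + s')) • (w + s • v) + (s / (s + s')) • (w + s' • -v) := by
    have h5 : s' / (s + s') = 1 - s / (s + s') := by field_simp; ring
    have h6 : (s' / (s + s')) * s = (s / (s + s')) * s' := by ring
    rw [smul_add, smul_add, smul_smul, smul_neg, smul_neg, smul_smul, h6, h5]
    module
  have hp1 : 0 < s' / (s + s') := by positivity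
  have hp2 : 0 < s / (s + s') := by positivity
  have h5 : 0 < ⟪u', (s' / (s + s')) • (w + s • v)⟫ := by
    rw [inner_smul_right]; exact mul_pos hp1 h2
  have h6 : 0 < ⟪u', (s / (s + s')) • (w + s' • -v)⟫ := by
    rw [inner_smul_right]; exact mul_pos hp2 h4
  have h7 := add_mem_lineCone hc' hu' (smul_mem_lineCone h1 (s' / (s + s')))
    (smul_mem_lineCone h3 (s / (s + s'))) h5 h6
  rw [← heq] at h7
  refine ⟨h7, ?_⟩
  rw [heq, inner_add_right]
  exact add_pos h5 h6

/-- Two double cones with the same frontier and at least one frontier ray on the same side have the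
same nappes, hence the same supporting hyperplanes through the apex. -/
theorem supportsAt_zero_of_frontier_lineCone_eq_of_pos [FiniteDimensional ℝ E]
    (hE : 3 ≤ Module.finrank ℝ E) (hQ : IsCompact Q) (hc : Convex ℝ Q)
    (hu : ∀ q ∈ Q, 0 < ⟪u, q⟫) {Q' : Set E} {u' : E} (hQ' : IsCompact Q') (hc' : Convex ℝ Q')
    (hu' : ∀ q ∈ Q', 0 < ⟪u', q⟫) (h : frontier (lineCone Q) = frontier (lineCone Q')) {b : E}
    (hb : b ∈ frontier (lineCone Q)) (hub : 0 < ⟪u, b⟫) (hub' : 0 < ⟪u', b⟫) {e : E}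
    (he : SupportsAt Q e 0) : SupportsAt Q' e 0 := by
  have hsub : frontier (lineCone Q) ⊆ lineCone Q := (isClosed_lineCone hQ hu).frontier_subset
  have hsub' : frontier (lineCone Q') ⊆ lineCone Q' :=
    (isClosed_lineCone hQ' hu').frontier_subset
  have hfwd : ∀ w ∈ lineCone Q, 0 < ⟪u, w⟫ → w ∈ lineCone Q' ∧ 0 < ⟪u', w⟫ := fun w hw hw0 =>
    mem_lineCone_and_inner_pos_of_frontier hE hQ hu hc' hu' (fun a ha hua =>
      ⟨hsub' (h ▸ ha), pos_of_mul_pos_left (inner_mul_inner_pos_of_frontier_lineCone_eq hE hQ hc hu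
        hQ' hu' h ha hb hua hub) hub'.le⟩) hw hw0
  have hbwd : ∀ w ∈ lineCone Q', 0 < ⟪u', w⟫ → w ∈ lineCone Q ∧ 0 < ⟪u, w⟫ := fun w hw hw0 =>
    mem_lineCone_and_inner_pos_of_frontier hE hQ' hu' hc hu (fun a ha hua =>
      ⟨hsub (h ▸ ha), pos_of_mul_pos_left (inner_mul_inner_pos_of_frontier_lineCone_eq hE hQ' hc'
        hu' hQ hu h.symm ha (h ▸ hb) hua hub') hub.le⟩) hw hw0
  obtain ⟨hle, q, hq, hq0⟩ := he
  simp only [inner_zero_right] at hle hq0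
  refine ⟨fun q' hq' => ?_, ?_⟩
  · obtain ⟨h1, h2⟩ := hbwd q' (subset_lineCone _ hq') (hu' q' hq')
    obtain ⟨p, hp, r, hr, rfl⟩ := exists_pos_smul_of_mem_lineCone hu h1 h2
    rw [inner_smul_right, inner_zero_right]
    exact mul_nonpos_of_nonneg_of_nonpos hr.le (hle p hp)
  · obtain ⟨h1, h2⟩ := hfwd q (subset_lineCone _ hq) (hu q hq)
    obtain ⟨p, hp, r, hr, rfl⟩ := exists_pos_smul_of_mem_lineCone hu' h1 h2
    refine ⟨p, hp, ?_⟩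
    rw [inner_smul_right] at hq0
    rw [inner_zero_right]
    exact (mul_eq_zero.1 hq0).resolve_left hr.ne'

theorem supportsAt_zero_of_frontier_lineCone_eq [FiniteDimensional ℝ E]
    (hE : 3 ≤ Module.finrank ℝ E) (hQ : IsCompact Q) (hc : Convex ℝ Q) (hne : Q.Nonempty)
    (hu : ∀ q ∈ Q, 0 < ⟪u, q⟫) {Q' : Set E} {u' : E} (hQ' : IsCompact Q') (hc' : Convex ℝ Q')
    (hu' : ∀ q ∈ Q', 0 < ⟪u', q⟫) (h : frontier (lineCone Q) = frontier (lineCone Q')) :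
    (∀ e, SupportsAt Q e 0 → SupportsAt Q' e 0) ∨
      (∀ e, SupportsAt Q e 0 → SupportsAt Q' (-e) 0) := by
  obtain ⟨q, hq⟩ := hne
  obtain ⟨v, hv0, huv, -⟩ := exists_ne_zero_inner_eq_zero_of_three_le_finrank hE u u
  obtain ⟨s, -, hb⟩ := exists_add_smul_mem_frontier_lineCone hQ hu (subset_lineCone _ hq) huv hv0
  have hub : 0 < ⟪u, q + s • v⟫ := by
    rw [inner_add_right, inner_smul_right, huv, mul_zero, add_zero]
    exact hu q hq
  rcases lt_trichotomy ⟪u', q + s • v⟫ 0 with h0 | h0 | h0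
  · refine Or.inr fun e he => ?_
    have hneg := supportsAt_zero_of_frontier_lineCone_eq_of_pos hE hQ hc hu (Q' := -Q') (u' := -u')
      hQ'.neg hc'.neg (fun p hp => by simpa using hu' (-p) hp) (by rw [lineCone_neg, h]) hb hub
      (by rw [inner_neg_left]; linarith) he
    refine ⟨fun k hk => ?_, ?_⟩
    · have := hneg.1 (-k) (by simpa using hk)
      simpa using this
    · obtain ⟨k, hk, hk0⟩ := hneg.2
      exact ⟨-k, hk, by simpa using hk0⟩
  · exact absurd (inner_mul_inner_pos_of_frontier_lineCone_eq hE hQ hc hu hQ' hu' h hb hb hub hub)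
      (by simp [h0])
  · exact Or.inl fun e he => supportsAt_zero_of_frontier_lineCone_eq_of_pos hE hQ hc hu hQ' hc' hu'
      h hb hub h0 he

end Cones

/-! ### Maps reversing supporting hyperplanes -/

section SupportingHyperplanes

variable {E : Type*} [NormedAddCommGroup E] [InnerProductSpace ℝ E]

theorem supportsAt_neg_vadd_iff {K : Set E} {x u : E} :
    SupportsAt (-x +ᵥ K) u 0 ↔ SupportsAt K u x := by
  unfold SupportsAt
  have h : ∀ k, ⟪u, -x + k⟫ = ⟪u, k⟫ - ⟪u, x⟫ := fun k => by
    rw [inner_add_right, inner_neg_right]; ring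
  constructor
  · rintro ⟨h1, -, ⟨k, hk, rfl⟩, h2⟩
    refine ⟨fun l hl => ?_, k, hk, ?_⟩
    · have := h1 _ ⟨l, hl, rfl⟩
      simp only [vadd_eq_add, h, inner_zero_right] at this
      linarith
    · simp only [vadd_eq_add, h, inner_zero_right] at h2
      linarith
  · rintro ⟨h1, k, hk, h2⟩
    refine ⟨?_, -x + k, ⟨k, hk, rfl⟩, ?_⟩
    · rintro _ ⟨l, hl, rfl⟩
      simp only [vadd_eq_add, h, inner_zero_right]
      linarith [h1 l hl]
    · rw [h, inner_zero_right]; linarith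

theorem eq_of_strictConvex_of_inner_eq {K : Set E} (hK : StrictConvex ℝ K) {u k l : E}
    (hu : u ≠ 0) (hk : k ∈ K) (hl : l ∈ K) (hmax : ∀ m ∈ K, ⟪u, m⟫ ≤ ⟪u, l⟫)
    (h : ⟪u, k⟫ = ⟪u, l⟫) : k = l := by
  by_contra hne
  obtain ⟨m, hm, hlt⟩ := inner_lt_of_mem_interior hu
    (hK hk hl hne (a := 1 / 2) (b := 1 / 2) (by norm_num) (by norm_num) (by norm_num))
  rw [inner_add_right, inner_smul_right, inner_smul_right, h] at hlt
  linarith [hmax m hm]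

theorem eq_of_supportsAt_imp [FiniteDimensional ℝ E] (hE : 3 ≤ Module.finrank ℝ E) {K : Set E}
    (hK : IsCompact K) (hc : Convex ℝ K) (hi : (interior K).Nonempty) {x y : E} (hx : x ∉ K)
    (h : ∀ e, SupportsAt K e x → SupportsAt K e y) : y = x := by
  by_contra hne
  obtain ⟨e, he, -, hexy⟩ := exists_supportsAt_inner_ne_zero hE hK hc hi (x := x) (d := 0)
    (by simpa using hx) (w := y - x) (by simpa [sub_eq_zero] using hne)
  rw [inner_sub_right, (h e he).inner_eq he, sub_self] at hexy
  exact hexy rfl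

variable {K L : Set E} {σ : E → E}

/-- Supporting hyperplanes through both `x` and `x'` show that a map reversing supporting
hyperplanes preserves the direction of a line `x x'` missing `K`. -/
theorem exists_sub_eq_smul_of_line_disjoint [FiniteDimensional ℝ E]
    (hE : 3 ≤ Module.finrank ℝ E) (hK : IsCompact K) (hc : Convex ℝ K)
    (hi : (interior K).Nonempty)
    (hσ : ∀ x ∈ L, ∀ e, SupportsAt K e x → SupportsAt K (-e) (σ x)) {x x' : E} (hx : x ∈ L)
    (hx' : x' ∈ L) (hd : ∀ r : ℝ, x + r • (x' - x) ∉ K) :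
    ∃ t : ℝ, σ x' - σ x = t • (x' - x) := by
  by_contra! h
  obtain ⟨e, he, hed, hew⟩ := exists_supportsAt_inner_ne_zero hE hK hc hi hd h
  have he' : SupportsAt K e x' := he.of_inner_eq (by rwa [inner_sub_right, sub_eq_zero] at hed)
  have := (hσ x hx e he).inner_eq (hσ x' hx' e he')
  rw [inner_neg_left, inner_neg_left, neg_inj] at this
  rw [inner_sub_right, this, sub_self] at hew
  exact hew rfl

/-- On the part of `L` in a supporting hyperplane of `K`, the map `σ` has the form
`x ↦ t • x + c`: it preserves the direction of all lines avoiding the point of contact `z`, and there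
are points of `L` in all directions from `z`. -/
theorem exists_eq_smul_add_on_supporting_hyperplane [FiniteDimensional ℝ E]
    (hE : 3 ≤ Module.finrank ℝ E) (hK : IsCompact K) (hc : StrictConvex ℝ K)
    (hi : (interior K).Nonempty) (hKL : Disjoint K L)
    (hray : ∀ w ∈ K, ∀ v : E, v ≠ 0 → ∃ s : ℝ, 0 < s ∧ w + s • v ∈ L)
    (hσ : ∀ x ∈ L, ∀ e, SupportsAt K e x → SupportsAt K (-e) (σ x)) {u : E} (hu : u ≠ 0) :
    ∃ (t : ℝ) (c : E), ∀ x ∈ L, SupportsAt K u x → σ x = t • x + c := by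
  obtain ⟨z, hz, hmax⟩ := hK.exists_isMaxOn (hi.mono interior_subset)
    (f := fun k => ⟪u, k⟫) (by fun_prop)
  replace hmax : ∀ k ∈ K, ⟪u, k⟫ ≤ ⟪u, z⟫ := fun k hk => hmax hk
  have hzs : SupportsAt K u z := ⟨hmax, z, hz, rfl⟩
  -- Points of `L` in the hyperplane are written `z + a`.
  have hpar : ∀ a b : E, z + a ∈ L → z + b ∈ L → ⟪u, a⟫ = 0 → ⟪u, b⟫ = 0 →
      LinearIndependent ℝ ![a, b] → ∃ t : ℝ, σ (z + b) - σ (z + a) = t • (b - a) := by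
    intro a b ha hb hua hub hind
    obtain ⟨t, ht⟩ := exists_sub_eq_smul_of_line_disjoint hE hK hc.convex hi hσ ha hb (fun r hr => by
      have h1 := eq_of_strictConvex_of_inner_eq hc hu hr hz hmax (by
        simp only [inner_add_right, inner_smul_right, inner_sub_right, hua, hub]; ring)
      have h2 : (1 - r) • a + r • b = 0 := by
        have : (1 - r) • a + r • b = z + a + r • (z + b - (z + a)) - z := by module
        rw [this, h1, sub_self]
      obtain ⟨h3, h4⟩ := LinearIndependent.pair_iff.1 hind _ _ h2
      linarith)
    exact ⟨t, by rw [ht]; congr 1; abel⟩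
  obtain ⟨v, hv0, huv, -⟩ := exists_ne_zero_inner_eq_zero_of_three_le_finrank hE u u
  obtain ⟨v', hv0', huv', hvv'⟩ := exists_ne_zero_inner_eq_zero_of_three_le_finrank hE u v
  obtain ⟨s, hs, hsL⟩ := hray z hz v hv0
  obtain ⟨s', hs', hsL'⟩ := hray z hz v' hv0'
  obtain ⟨a, ha⟩ : ∃ a, a = s • v := ⟨_, rfl⟩
  obtain ⟨b, hb⟩ : ∃ b, b = s' • v' := ⟨_, rfl⟩
  rw [← ha] at hsL
  rw [← hb] at hsL'
  have hua : ⟪u, a⟫ = 0 := by rw [ha, inner_smul_right, huv, mul_zero]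
  have hub : ⟪u, b⟫ = 0 := by rw [hb, inner_smul_right, huv', mul_zero]
  have hab : ⟪a, b⟫ = 0 := by
    rw [ha, hb, inner_smul_right, real_inner_smul_left, hvv', mul_zero, mul_zero]
  have ha0 : a ≠ 0 := ha ▸ smul_ne_zero hs.ne' hv0
  have hb0 : b ≠ 0 := hb ▸ smul_ne_zero hs'.ne' hv0'
  have hind : ∀ α β : ℝ, α • a + β • b = 0 → α = 0 ∧ β = 0 := by
    intro α β h
    constructor
    · have h1 : ⟪a, α • a + β • b⟫ = 0 := by rw [h, inner_zero_right]
      rw [inner_add_right, inner_smul_right, inner_smul_right, hab, mul_zero, add_zero] at h1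
      exact (mul_eq_zero.1 h1).resolve_right (inner_self_ne_zero.2 ha0)
    · have h1 : ⟪b, α • a + β • b⟫ = 0 := by rw [h, inner_zero_right]
      rw [inner_add_right, inner_smul_right, inner_smul_right, real_inner_comm, hab, mul_zero,
        zero_add] at h1
      exact (mul_eq_zero.1 h1).resolve_right (inner_self_ne_zero.2 hb0)
  obtain ⟨t, ht⟩ := hpar a b hsL hsL' hua hub (LinearIndependent.pair_iff.2 hind)
  -- `G` measures the failure of the formula; it vanishes at `a` and `b` by the choice of `t`.
  obtain ⟨G, hG⟩ : ∃ G : E → E,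
      ∀ y, G y = σ (z + y) - t • (z + y) - (σ (z + a) - t • (z + a)) := ⟨_, fun _ => rfl⟩
  have hGpar : ∀ p q : E, z + p ∈ L → z + q ∈ L → ⟪u, p⟫ = 0 → ⟪u, q⟫ = 0 →
      LinearIndependent ℝ ![p, q] → G p = 0 → ∃ r : ℝ, G q = r • (q - p) := by
    intro p q hp hq hup huq hpq hGp
    obtain ⟨r, hr⟩ := hpar p q hp hq hup huq hpq
    refine ⟨r - t, ?_⟩
    have h1 : G q = (σ (z + q) - σ (z + p)) - t • (q - p) + G p := by rw [hG, hG]; module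
    rw [h1, hGp, hr]; module
  have hGa : G a = 0 := by rw [hG, sub_self]
  have hGb : G b = 0 := by
    have : G b = (σ (z + b) - σ (z + a)) - t • (b - a) := by rw [hG]; module
    rw [this, ht, sub_self]
  -- `G` vanishes in the directions `± (a - b)`, comparing with `a` and `b`.
  have hG1 : ∀ α : ℝ, z + α • (a - b) ∈ L → G (α • (a - b)) = 0 := by
    intro α hα
    have hα0 : α ≠ 0 := by
      rintro rfl
      rw [zero_smul, add_zero] at hα
      exact Set.disjoint_left.1 hKL hz hα
    have hu0 : ⟪u, α • (a - b)⟫ = 0 := by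
      rw [inner_smul_right, inner_sub_right, hua, hub, sub_self, mul_zero]
    obtain ⟨r, hr⟩ := hGpar a _ hsL hα hua hu0 (LinearIndependent.pair_iff.2 fun m k h => by
      have h1 : (m + k * α) • a + (-(k * α)) • b = 0 := by rw [← h]; module
      obtain ⟨h2, h3⟩ := hind _ _ h1
      have hk : k = 0 := (mul_eq_zero.1 (neg_eq_zero.1 h3)).resolve_right hα0
      exact ⟨by simpa [hk] using h2, hk⟩) hGa
    obtain ⟨r', hr'⟩ := hGpar b _ hsL' hα hub hu0 (LinearIndependent.pair_iff.2 fun m k h => by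
      have h1 : (k * α) • a + (m - k * α) • b = 0 := by rw [← h]; module
      obtain ⟨h2, h3⟩ := hind _ _ h1
      have hk : k = 0 := (mul_eq_zero.1 h2).resolve_right hα0
      exact ⟨by simpa [hk] using h3, hk⟩) hGb
    have h1 : (r * (α - 1) - r' * α) • a + (r' * (α + 1) - r * α) • b = 0 := by
      have : (r * (α - 1) - r' * α) • a + (r' * (α + 1) - r * α) • b
          = r • (α • (a - b) - a) - r' • (α • (a - b) - b) := by module
      rw [this, ← hr, ← hr', sub_self]
    obtain ⟨h2, h3⟩ := hind _ _ h1
    have hrr : r' = r := by linear_combination h2 + h3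
    have h4 : r = 0 := by linear_combination -h2 - α * hrr
    rw [hr, h4, zero_smul]
  have hab0 : a - b ≠ 0 := by
    intro h
    have := (hind 1 (-1) (by rw [← h]; module)).1
    norm_num at this
  obtain ⟨m, hm, hmL⟩ := hray z hz (a - b) hab0
  obtain ⟨k, hk, hkL⟩ := hray z hz (-(a - b)) (neg_ne_zero.2 hab0)
  have hkL' : z + (-k) • (a - b) ∈ L := by rwa [neg_smul, ← smul_neg]
  have huv0 : ∀ r : ℝ, ⟪u, r • (a - b)⟫ = 0 := fun r => by
    rw [inner_smul_right, inner_sub_right, hua, hub, sub_self, mul_zero]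
  -- All other points are compared with the two points on the line `ℝ (a - b)`.
  have hG2 : ∀ y, z + y ∈ L → ⟪u, y⟫ = 0 → G y = 0 := by
    intro y hy huy
    by_cases hyab : ∃ α : ℝ, y = α • (a - b)
    · obtain ⟨α, rfl⟩ := hyab
      exact hG1 α hy
    · push Not at hyab
      have hyind : ∀ r r' : ℝ, r • (a - b) + r' • y = 0 → r = 0 ∧ r' = 0 := by
        intro r r' h
        have hr' : r' = 0 := by
          by_contra hr'
          apply hyab (-(r / r'))
          have h1 : r' • y = -(r • (a - b)) := eq_neg_of_add_eq_zero_right h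
          rw [neg_smul, div_eq_inv_mul, mul_smul, ← smul_neg, ← h1, smul_smul,
            inv_mul_cancel₀ hr', one_smul]
        rw [hr', zero_smul, add_zero] at h
        exact ⟨(smul_eq_zero.1 h).resolve_right hab0, hr'⟩
      have hcmp : ∀ μ : ℝ, μ ≠ 0 → z + μ • (a - b) ∈ L →
          ∃ r : ℝ, G y = r • (y - μ • (a - b)) := fun μ hμ hμL =>
        hGpar _ y hμL hy (huv0 μ) huy (LinearIndependent.pair_iff.2 fun r r' h => by
          rw [smul_smul] at h
          obtain ⟨h1, h2⟩ := hyind _ _ h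
          exact ⟨(mul_eq_zero.1 h1).resolve_right hμ, h2⟩) (hG1 μ hμL)
      obtain ⟨r, hr⟩ := hcmp m hm.ne' hmL
      obtain ⟨r', hr'⟩ := hcmp (-k) (neg_ne_zero.2 hk.ne') hkL'
      have h1 : (-(r * m) - r' * k) • (a - b) + (r - r') • y = 0 := by
        have : (-(r * m) - r' * k) • (a - b) + (r - r') • y
            = r • (y - m • (a - b)) - r' • (y - (-k) • (a - b)) := by module
        rw [this, ← hr, ← hr', sub_self]
      obtain ⟨h2, h3⟩ := hyind _ _ h1
      have h4 : r * (m + k) = 0 := by linear_combination -h2 + k * h3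
      have h5 : r = 0 := (mul_eq_zero.1 h4).resolve_right (by positivity)
      rw [hr, h5, zero_smul]
  refine ⟨t, σ (z + a) - t • (z + a), fun x hx hxs => ?_⟩
  have h1 := hG2 (x - z) (by rwa [add_sub_cancel])
    (by rw [inner_sub_right, hxs.inner_eq hzs, sub_self])
  rw [hG, add_sub_cancel] at h1
  rw [sub_sub, sub_eq_zero] at h1
  exact h1

/-- Supporting hyperplanes of `K` with normals close to each other intersect near their points of
contact, hence have two common points on `L`. -/
theorem eventually_exists_ne_supportsAt [FiniteDimensional ℝ E]
    (hE : 3 ≤ Module.finrank ℝ E) (hK : IsCompact K) (hc : StrictConvex ℝ K)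
    (hi : (interior K).Nonempty) {U : Set E} (hU : IsOpen U) (hKU : K ⊆ U)
    (hray : ∀ w ∈ U, ∀ v : E, v ≠ 0 → ∃ s : ℝ, 0 < s ∧ w + s • v ∈ L) {u : E} (hu : u ≠ 0) :
    ∀ᶠ u' in nhds u, ∃ x ∈ L, ∃ y ∈ L, x ≠ y ∧ SupportsAt K u x ∧ SupportsAt K u y ∧
      SupportsAt K u' x ∧ SupportsAt K u' y := by
  have hne : K.Nonempty := hi.mono interior_subset
  obtain ⟨z, hz, hmax⟩ := hK.exists_isMaxOn hne (f := fun k => ⟪u, k⟫) (by fun_prop)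
  replace hmax : ∀ k ∈ K, ⟪u, k⟫ ≤ ⟪u, z⟫ := fun k hk => hmax hk
  obtain ⟨δ, hδ, hball⟩ := Metric.isOpen_iff.1 hU z (hKU hz)
  have hfar : ∀ᶠ u' in nhds u, ∀ k ∈ K \ Metric.ball z δ, ⟪u', k⟫ < ⟪u', z⟫ := by
    refine (hK.diff Metric.isOpen_ball).eventually_forall_of_forall_eventually fun k hk => ?_
    have hlt : ⟪u, k⟫ < ⟪u, z⟫ := lt_of_le_of_ne (hmax k hk.1) fun h =>
      hk.2 (eq_of_strictConvex_of_inner_eq hc hu hk.1 hz hmax h ▸ Metric.mem_ball_self hδ)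
    have hopen : IsOpen {p : E × E | ⟪p.1, p.2⟫ < ⟪p.1, z⟫} :=
      isOpen_lt (by fun_prop) (by fun_prop)
    exact hopen.mem_nhds hlt
  have hpos : ∀ᶠ u' in nhds u, 0 < ⟪u, u'⟫ :=
    (isOpen_lt (by fun_prop) (by fun_prop) : IsOpen {u' : E | 0 < ⟪u, u'⟫}).mem_nhds
      (real_inner_self_pos.2 hu)
  filter_upwards [hfar, hpos] with u' hfar hpos
  obtain ⟨z', hz', hmax'⟩ := hK.exists_isMaxOn hne (f := fun k => ⟪u', k⟫) (by fun_prop)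
  replace hmax' : ∀ k ∈ K, ⟪u', k⟫ ≤ ⟪u', z'⟫ := fun k hk => hmax' hk
  have hzz' : ‖z' - z‖ < δ := by
    rw [← mem_ball_iff_norm]
    by_contra h
    exact (hfar z' ⟨hz', h⟩).not_ge (hmax' z hz)
  have huu : 0 < ⟪u, u⟫ := real_inner_self_pos.2 hu
  -- The point of both hyperplanes that is closest to `z` is `z + s • e`, where `e` is the part
  -- of `u'` orthogonal to `u`. If `e = 0`, the two hyperplanes coincide, and `s = 0 / 0 = 0`.
  obtain ⟨κ, hκ⟩ : ∃ κ, κ = ⟪u, u'⟫ / ⟪u, u⟫ := ⟨_, rfl⟩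
  have hκ0 : 0 < κ := hκ ▸ div_pos hpos huu
  obtain ⟨e, he⟩ : ∃ e, e = u' - κ • u := ⟨_, rfl⟩
  have hue : ⟪u, e⟫ = 0 := by
    rw [he, inner_sub_right, inner_smul_right, hκ, div_mul_cancel₀ _ huu.ne', sub_self]
  have hu' : u' = e + κ • u := by rw [he]; abel
  have hu'e : ⟪u', e⟫ = ⟪e, e⟫ := by
    rw [hu', inner_add_left, real_inner_smul_left, hue, mul_zero, add_zero]
  have h0 : 0 ≤ ⟪u', z' - z⟫ := by rw [inner_sub_right]; linarith [hmax' z hz]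
  have h1 : ⟪u', z' - z⟫ ≤ ⟪e, z' - z⟫ := by
    rw [hu', inner_add_left, real_inner_smul_left, inner_sub_right u]
    nlinarith [hmax z' hz']
  obtain ⟨s, hs⟩ : ∃ s, s = ⟪u', z' - z⟫ / ⟪e, e⟫ := ⟨_, rfl⟩
  have hse : s * ⟪e, e⟫ = ⟪u', z' - z⟫ := by
    by_cases he0 : e = 0
    · rw [he0, inner_zero_left] at h1
      rw [he0, inner_zero_left, mul_zero]
      exact le_antisymm h0 h1
    · rw [hs, div_mul_cancel₀ _ (inner_self_ne_zero.2 he0)]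
  have hs0 : 0 ≤ s := hs ▸ div_nonneg h0 real_inner_self_nonneg
  have hnorm : ‖s • e‖ < δ := by
    refine lt_of_le_of_lt ?_ hzz'
    rw [norm_smul, Real.norm_of_nonneg hs0]
    rcases (norm_nonneg e).eq_or_lt with he0 | he0
    · rw [← he0, mul_zero]; exact norm_nonneg _
    · have h2 := h1.trans (real_inner_le_norm e (z' - z))
      rw [← hse, real_inner_self_eq_norm_mul_norm] at h2
      nlinarith
  have hw : z + s • e ∈ U := hball (by rw [mem_ball_iff_norm, add_sub_cancel_left]; exact hnorm)
  obtain ⟨v, hv0, huv, huv'⟩ := exists_ne_zero_inner_eq_zero_of_three_le_finrank hE u u'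
  obtain ⟨r, hr, hrL⟩ := hray _ hw v hv0
  obtain ⟨r', hr', hrL'⟩ := hray _ hw (-v) (neg_ne_zero.2 hv0)
  have hzs : SupportsAt K u z := ⟨hmax, z, hz, rfl⟩
  have hzs' : SupportsAt K u' z' := ⟨hmax', z', hz', rfl⟩
  rw [inner_sub_right] at hse
  refine ⟨_, hrL, _, hrL', ?_, hzs.of_inner_eq ?_, hzs.of_inner_eq ?_, hzs'.of_inner_eq ?_,
    hzs'.of_inner_eq ?_⟩
  · intro h
    have h2 : (r + r') • v = 0 := by
      have : (r + r') • v = (z + s • e + r • v) - (z + s • e + r' • -v) := by module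
      rw [this, h, sub_self]
    rcases smul_eq_zero.1 h2 with h2 | h2
    · linarith
    · exact hv0 h2
  all_goals
    simp only [inner_add_right, inner_smul_right, inner_neg_right, hue, huv, huv', hu'e]
    linarith

theorem exists_supportsAt_of_ray (hE : 3 ≤ Module.finrank ℝ E) [FiniteDimensional ℝ E]
    (hK : IsCompact K) (hne : K.Nonempty)
    (hray : ∀ w ∈ K, ∀ v : E, v ≠ 0 → ∃ s : ℝ, 0 < s ∧ w + s • v ∈ L) (u : E) :
    ∃ x ∈ L, SupportsAt K u x := by
  obtain ⟨z, hz, hmax⟩ := hK.exists_isMaxOn hne (f := fun k => ⟪u, k⟫) (by fun_prop)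
  obtain ⟨v, hv0, huv, -⟩ := exists_ne_zero_inner_eq_zero_of_three_le_finrank hE u u
  obtain ⟨s, -, hs⟩ := hray z hz v hv0
  have hzs : SupportsAt K u z := ⟨fun k hk => hmax hk, z, hz, rfl⟩
  exact ⟨_, hs, hzs.of_inner_eq (by rw [inner_add_right, inner_smul_right, huv]; ring)⟩

/-- The formulas on the supporting hyperplanes agree, as neighbouring ones agree at two points
and the set of normals is connected. -/
theorem exists_eq_smul_add_of_supportsAt_neg [FiniteDimensional ℝ E]
    (hE : 3 ≤ Module.finrank ℝ E) (hK : IsCompact K) (hc : StrictConvex ℝ K)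
    (hi : (interior K).Nonempty) (hKL : Disjoint K L) {U : Set E} (hU : IsOpen U) (hKU : K ⊆ U)
    (hray : ∀ w ∈ U, ∀ v : E, v ≠ 0 → ∃ s : ℝ, 0 < s ∧ w + s • v ∈ L)
    (hσ : ∀ x ∈ L, ∀ e, SupportsAt K e x → SupportsAt K (-e) (σ x)) :
    ∃ (t : ℝ) (c : E), ∀ x ∈ L, σ x = t • x + c := by
  have hex : ∀ u : E, u ≠ 0 → ∃ (t : ℝ) (c : E), ∀ x ∈ L, SupportsAt K u x → σ x = t • x + c :=
    fun u hu => exists_eq_smul_add_on_supporting_hyperplane hE hK hc hi hKL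
      (fun w hw => hray w (hKU hw)) hσ hu
  choose! t c htc using hex
  have hconn : IsPreconnected ({0}ᶜ : Set E) := by
    refine (isConnected_compl_singleton_of_one_lt_rank ?_ 0).isPreconnected
    rw [← Module.finrank_eq_rank]
    exact_mod_cast (show 1 < Module.finrank ℝ E by omega)
  have hconst : ∀ u u' : E, u ≠ 0 → u' ≠ 0 → t u = t u' ∧ c u = c u' := by
    intro u u' hu hu'
    refine hconn.induction₂ (fun u u' => t u = t u' ∧ c u = c u') (fun u hu => ?_)
      (fun _ _ _ _ _ _ h h' => ⟨h.1.trans h'.1, h.2.trans h'.2⟩)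
      (fun _ _ _ _ h => ⟨h.1.symm, h.2.symm⟩) hu hu'
    have hev := (eventually_exists_ne_supportsAt hE hK hc hi hU hKU hray hu).filter_mono
      (nhdsWithin_le_nhds (s := {0}ᶜ))
    filter_upwards [hev, self_mem_nhdsWithin] with u' hex hu'
    obtain ⟨x, hx, y, hy, hxy, h1, h2, h3, h4⟩ := hex
    have hxeq := (htc u hu x hx h1).symm.trans (htc u' hu' x hx h3)
    have hyeq := (htc u hu y hy h2).symm.trans (htc u' hu' y hy h4)
    have ht : t u = t u' := by
      have h5 : (t u - t u') • (x - y) = 0 := by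
        have : (t u - t u') • (x - y) = ((t u • x + c u) - (t u' • x + c u'))
            - ((t u • y + c u) - (t u' • y + c u')) := by module
        rw [this, hxeq, hyeq, sub_self, sub_self, sub_self]
      rcases smul_eq_zero.1 h5 with h5 | h5
      · linarith
      · exact absurd (sub_eq_zero.1 h5) hxy
    rw [ht] at hxeq
    exact ⟨ht, add_left_cancel hxeq⟩
  obtain ⟨e, he, -⟩ := exists_ne_zero_inner_eq_zero_of_three_le_finrank hE 0 0
  refine ⟨t e, c e, fun x hx => ?_⟩
  obtain ⟨u, hu, -, hue⟩ := exists_supportsAt_inner_ne_zero hE hK hc.convex hi (x := x) (d := 0)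
    (by simpa using Set.disjoint_right.1 hKL hx) (w := e) (by simpa using he)
  have hu0 : u ≠ 0 := by rintro rfl; simp at hue
  obtain ⟨h1, h2⟩ := hconst e u he hu0
  rw [h1, h2]
  exact htc u hu0 x hx hu

/-- If opposite supporting hyperplanes of `K` are interchanged by the reflection `x ↦ c - x` on
`L`, then `K` is symmetric under it: its support function `h` satisfies `h (-u) = h u - ⟪u, c⟫`. -/
theorem sub_mem_of_supportsAt_neg [CompleteSpace E] (hK : IsCompact K) (hc : Convex ℝ K) {c : E}
    (hex : ∀ u, ∃ x ∈ L, SupportsAt K u x)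
    (hσ : ∀ x ∈ L, ∀ e, SupportsAt K e x → SupportsAt K (-e) (c - x)) {k : E} (hk : k ∈ K) :
    c - k ∈ K := by
  by_contra h
  obtain ⟨u, -, hu⟩ := exists_inner_pos_of_line_disjoint hK hc (x := c - k) (d := 0)
    (by simpa using h)
  obtain ⟨x, hx, hux⟩ := hex u
  obtain ⟨l, hl, hlx⟩ := (hσ x hx _ hux).2
  have h1 := hu l hl
  have h2 := hux.1 k hk
  simp only [inner_neg_left, inner_sub_right] at h1 hlx
  linarith

end SupportingHyperplanes

/-! ### Enclosed regions and support double-cones -/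

section EuclideanSpace

variable {n : ℕ}

theorem exists_add_smul_mem_of_mem_enclosedRegion {L : Set (EuclideanSpace ℝ (Fin n))}
    {w : EuclideanSpace ℝ (Fin n)} (hw : w ∈ enclosedRegion L) {v : EuclideanSpace ℝ (Fin n)}
    (hv : v ≠ 0) : ∃ s : ℝ, 0 < s ∧ w + s • v ∈ L := by
  by_contra! h
  have hsub : (fun s : ℝ => w + s • v) '' Set.Ici 0 ⊆ Lᶜ := by
    rintro _ ⟨s, hs, rfl⟩
    rcases (Set.mem_Ici.1 hs).eq_or_lt with rfl | hs
    · simpa using hw.1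
    · exact h s hs
  have hpre : IsPreconnected ((fun s : ℝ => w + s • v) '' Set.Ici 0) :=
    isPreconnected_Ici.image _ (by fun_prop)
  have hcomp := hpre.subset_connectedComponentIn (x := w) ⟨0, by simp, by simp⟩ hsub
  obtain ⟨R, hR⟩ := (hw.2.subset hcomp).exists_norm_le
  have hv' := norm_pos_iff.2 hv
  have hR0 : 0 ≤ R := (norm_nonneg _).trans (hR _ ⟨0, by simp, rfl⟩)
  have h1 := hR _ ⟨(R + ‖w‖ + 1) / ‖v‖, Set.mem_Ici.2 (by positivity), rfl⟩
  have h2 := norm_sub_le (w + ((R + ‖w‖ + 1) / ‖v‖) • v) w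
  rw [add_sub_cancel_left, norm_smul, Real.norm_of_nonneg (by positivity),
    div_mul_cancel₀ _ hv'.ne'] at h2
  linarith

theorem isOpen_enclosedRegion {L : Set (EuclideanSpace ℝ (Fin n))} (hL : IsClosed L) :
    IsOpen (enclosedRegion L) := by
  rw [isOpen_iff_mem_nhds]
  intro z hz
  have hzc : z ∈ Lᶜ := hz.1
  filter_upwards [hL.isOpen_compl.connectedComponentIn.mem_nhds (mem_connectedComponentIn hzc)]
    with w hw
  refine ⟨connectedComponentIn_subset _ _ hw, ?_⟩
  rw [← connectedComponentIn_eq hw]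
  exact hz.2

theorem mem_solidDoubleCone_iff {K : Set (EuclideanSpace ℝ (Fin n))}
    {x w : EuclideanSpace ℝ (Fin n)} : x + w ∈ solidDoubleCone K x ↔ w ∈ lineCone (-x +ᵥ K) := by
  simp only [solidDoubleCone, Set.mem_iUnion, exists_prop, SetLike.mem_coe, mem_affineSpan_pair_iff_exists_lineMap_eq,
    lineCone, Set.mem_ofPred_eq]
  constructor
  · rintro ⟨k, hk, r, hr⟩
    refine ⟨-x + k, ⟨k, hk, rfl⟩, r, ?_⟩
    rw [AffineMap.lineMap_apply, vsub_eq_sub, vadd_eq_add, add_comm] at hr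
    rw [neg_add_eq_sub]
    exact (add_left_cancel hr).symm
  · rintro ⟨_, ⟨k, hk, rfl⟩, r, rfl⟩
    refine ⟨k, hk, r, ?_⟩
    rw [AffineMap.lineMap_apply, vsub_eq_sub, vadd_eq_add, add_comm]
    simp only [vadd_eq_add, neg_add_eq_sub]

theorem mem_supportDoubleCone_iff {K : Set (EuclideanSpace ℝ (Fin n))}
    {x w : EuclideanSpace ℝ (Fin n)} :
    x + w ∈ supportDoubleCone K x ↔ w ∈ frontier (lineCone (-x +ᵥ K)) := by
  have h : lineCone (-x +ᵥ K) = Homeomorph.addLeft x ⁻¹' solidDoubleCone K x := by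
    ext w
    exact mem_solidDoubleCone_iff.symm
  rw [h, ← Homeomorph.preimage_frontier]
  rfl

/-- Translates of support double-cones with distinct apexes have interchanged nappes, so opposite
supporting hyperplanes. -/
theorem supportsAt_neg_of_supportDoubleCone_eq_vadd (hn : 3 ≤ n)
    {K : Set (EuclideanSpace ℝ (Fin n))} (hK : IsConvexBody K)
    {x y p : EuclideanSpace ℝ (Fin n)} (hx : x ∉ K) (hy : y ∉ K) (hyx : y ≠ x)
    (h : supportDoubleCone K y = p +ᵥ supportDoubleCone K x) {e : EuclideanSpace ℝ (Fin n)}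
    (he : SupportsAt K e x) : SupportsAt K (-e) y := by
  obtain ⟨hK, hc, hi⟩ := hK
  have hE : 3 ≤ Module.finrank ℝ (EuclideanSpace ℝ (Fin n)) := by simpa using hn
  have hsep : ∀ x ∉ K, ∃ u : EuclideanSpace ℝ (Fin n), ∀ q ∈ -x +ᵥ K, 0 < ⟪u, q⟫ := by
    intro x hx
    obtain ⟨u, -, hu⟩ := exists_inner_pos_of_line_disjoint hK hc (x := x) (d := 0)
      (by simpa using hx)
    refine ⟨u, ?_⟩
    rintro _ ⟨k, hk, rfl⟩
    simpa [neg_add_eq_sub] using hu k hk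
  obtain ⟨u, hu⟩ := hsep x hx
  obtain ⟨u', hu'⟩ := hsep y hy
  have hix : (interior (-x +ᵥ K)).Nonempty := by
    rw [interior_vadd]
    exact hi.vadd_set
  have htr : ∀ w, w ∈ frontier (lineCone (-y +ᵥ K)) ↔
      w - (p + x - y) ∈ frontier (lineCone (-x +ᵥ K)) := by
    intro w
    rw [← mem_supportDoubleCone_iff, ← mem_supportDoubleCone_iff, h,
      Set.mem_vadd_set_iff_neg_vadd_mem, vadd_eq_add]
    rw [show -p + (y + w) = x + (w - (p + x - y)) by abel]
  have hq := eq_zero_of_frontier_lineCone_translate hE (hK.vadd (-x)) hix hu htr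
  have hfr : frontier (lineCone (-x +ᵥ K)) = frontier (lineCone (-y +ᵥ K)) := by
    ext w
    rw [htr w, hq, sub_zero]
  rcases supportsAt_zero_of_frontier_lineCone_eq hE (hK.vadd (-x)) (hc.vadd (-x))
    (hix.mono interior_subset) hu (hK.vadd (-y)) (hc.vadd (-y)) hu' hfr with h1 | h1
  · refine absurd (eq_of_supportsAt_imp hE hK hc hi hx fun e he => ?_) hyx
    exact supportsAt_neg_vadd_iff.1 (h1 e (supportsAt_neg_vadd_iff.2 he))
  · exact supportsAt_neg_vadd_iff.1 (h1 e (supportsAt_neg_vadd_iff.2 he))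

theorem isCentrallySymmetric_half_smul {M : Set (EuclideanSpace ℝ (Fin n))}
    {c : EuclideanSpace ℝ (Fin n)} (h : ∀ z ∈ M, c - z ∈ M) :
    IsCentrallySymmetric M ((1 / 2 : ℝ) • c) := by
  have hc : (2 : ℝ) • (1 / 2 : ℝ) • c = c := by rw [smul_smul]; norm_num
  unfold IsCentrallySymmetric
  rw [hc]
  refine Set.Subset.antisymm ?_ fun z hz => ⟨c - z, h z hz, sub_sub_cancel c z⟩
  rintro _ ⟨z, hz, rfl⟩
  exact h z hz

end EuclideanSpace

/-! ### Central symmetry -/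

theorem theorem1 (n : ℕ) (hn : 3 ≤ n) (K L : Set (EuclideanSpace ℝ (Fin n)))
    (hK : IsStrictlyConvexBody K) (hL : IsEmbeddedSphere L) (hKL : K ⊆ enclosedRegion L)
    (hcone : ∀ x ∈ L, ∃ y ∈ L, y ≠ x ∧ ∃ p : EuclideanSpace ℝ (Fin n),
      supportDoubleCone K y = p +ᵥ supportDoubleCone K x) :
    ∃ c : EuclideanSpace ℝ (Fin n), IsCentrallySymmetric K c ∧ IsCentrallySymmetric L c := by
  have hE : 3 ≤ Module.finrank ℝ (EuclideanSpace ℝ (Fin n)) := by simpa using hn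
  obtain ⟨hKb, hsc⟩ := hK
  have hKb' := hKb
  obtain ⟨hKc, hc, hi⟩ := hKb'
  have hLc : IsClosed L := by
    obtain ⟨α, hα, rfl⟩ := hL
    exact (isCompact_range hα.continuous).isClosed
  have hdisj : Disjoint K L := Set.disjoint_left.2 fun z hz => (hKL hz).1
  have hnot : ∀ x ∈ L, x ∉ K := fun x hx => Set.disjoint_right.1 hdisj hx
  have hray : ∀ w ∈ enclosedRegion L, ∀ v : EuclideanSpace ℝ (Fin n), v ≠ 0 →
      ∃ s : ℝ, 0 < s ∧ w + s • v ∈ L := fun w hw v hv =>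
    exists_add_smul_mem_of_mem_enclosedRegion hw hv
  choose! σ hσL hσne hσp using hcone
  have hσ : ∀ x ∈ L, ∀ e, SupportsAt K e x → SupportsAt K (-e) (σ x) := by
    intro x hx e he
    obtain ⟨p, hp⟩ := hσp x hx
    exact supportsAt_neg_of_supportDoubleCone_eq_vadd hn hKb (hnot x hx) (hnot _ (hσL x hx))
      (hσne x hx) hp he
  have hinv : ∀ x ∈ L, σ (σ x) = x := fun x hx =>
    eq_of_supportsAt_imp hE hKc hc hi (hnot x hx) fun e he => by
      simpa using hσ _ (hσL x hx) _ (hσ x hx e he)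
  obtain ⟨t, c, htc⟩ := exists_eq_smul_add_of_supportsAt_neg hE hKc hsc hi hdisj
    (isOpen_enclosedRegion hLc) hKL hray hσ
  have hrayK := fun w hw => hray w (hKL hw)
  obtain ⟨x, hx, -⟩ := exists_supportsAt_of_ray hE hKc (hi.mono interior_subset) hrayK 0
  -- `σ` is a fixed-point-free involution, so `t = -1`.
  have ht : t = -1 := by
    have h1 : (t + 1) • (σ x - x) = 0 := by
      have h2 := hinv x hx
      rw [htc _ (hσL x hx)] at h2
      have : (t + 1) • (σ x - x) = (t • σ x + c) - x + (σ x - (t • x + c)) := by module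
      rw [this, h2, ← htc x hx, sub_self, sub_self, add_zero]
    rcases smul_eq_zero.1 h1 with h1 | h1
    · linarith
    · exact absurd (sub_eq_zero.1 h1) (hσne x hx)
  have hrefl : ∀ x ∈ L, σ x = c - x := fun x hx => by rw [htc x hx, ht]; module
  refine ⟨(1 / 2 : ℝ) • c, isCentrallySymmetric_half_smul fun k hk => ?_,
    isCentrallySymmetric_half_smul fun y hy => hrefl y hy ▸ hσL y hy⟩
  exact sub_mem_of_supportsAt_neg hKc hc
    (exists_supportsAt_of_ray hE hKc (hi.mono interior_subset) hrayK)
    (fun y hy e he => hrefl y hy ▸ hσ y hy e he) hk
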